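/- For a Borel probability measure $\mu$ on $\mathbb{R}$ put $G_\mu(z)=\int_{\mathbb{R}}\frac{1}{z-x}\,d\mu(x)$ and $H_\mu(z)=1/G_\mu(z)$ for $z\in\mathbb{C}\setminus\mathbb{R}$. Let $\mathcal{P}$ be the set of all Borel probability measures on $\mathbb{R}$, $\mathcal{P}_+\subset\mathcal{P}$ the set of those whose support is contained in $[0,\infty)$, and $\mathcal{P}_s\subset\mathcal{P}$ the set of those that are symmetric (invariant under $x\mapsto -x$). Let $T:\mathcal{P}\to\mathcal{P}$ be an arbitrary map. For $\mu,\nu\in\mathcal{P}$, let $\mu\rhd_T\nu$ be the first component of the conditionally monotone convolution $(\mu,T\mu)\rhd(\nu,T\nu)$, that is, the probability measure characterized by $$H_{\mu\rhd_T\nu}=H_\mu\circ H_{T\nu}+H_\nu-H_{T\nu}\quad\text{on }\mathbb{C}\setminus\mathbb{R}.$$ This is well defined: for all $\mu,\nu\in\mathcal{P}$ there is exactly one such probability measure. Moreover: (1) The following two conditions are equivalent: (1a) $T(\mathcal{P}_+)\subset\mathcal{P}_+$; (1b) $\mu\rhd_T\nu\in\mathcal{P}_+$ for all $\mu,\nu\in\mathcal{P}_+$.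 (2) The following two conditions are equivalent: (2a) $T(\mathcal{P}_s)\subset\mathcal{P}_s$; (2b) $\mu\rhd_T\nu\in\mathcal{P}_s$ for all $\mu,\nu\in\mathcal{P}_s$. -/

import Mathlib

open MeasureTheory

noncomputable section

/-- The Cauchy transform `G_μ(z) = ∫ 1 / (z - x) dμ(x)`, used for non-real `z`, where the integrand
is bounded and continuous in `x`. -/
def cauchyTransform (μ : ProbabilityMeasure ℝ) (z : ℂ) : ℂ :=
  ∫ x : ℝ, 1 / (z - (x : ℂ)) ∂(μ : Measure ℝ)

/-- The reciprocal Cauchy transform `H_μ = 1 / G_μ`, used for non-real `z`, where `G_μ(z) ≠ 0`. -/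
def recipCauchyTransform (μ : ProbabilityMeasure ℝ) (z : ℂ) : ℂ :=
  1 / cauchyTransform μ z

/-- `IsCMonotoneConv μ₁ ν₂ μ₂ ρ` says that `ρ` is the left component `μ₁ ▷_{ν₂} μ₂` of the additive
conditionally monotone convolution `(μ₁, ν₁) ▷ (μ₂, ν₂) = (μ₁ ▷_{ν₂} μ₂, ν₁ ▷ ν₂)`:
`H_ρ = H_{μ₁} ∘ H_{ν₂} + H_{μ₂} - H_{ν₂}` on `ℂ ∖ ℝ`. -/
def IsCMonotoneConv (μ₁ ν₂ μ₂ ρ : ProbabilityMeasure ℝ) : Prop :=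
  ∀ z : ℂ, z.im ≠ 0 →
    recipCauchyTransform ρ z =
      recipCauchyTransform μ₁ (recipCauchyTransform ν₂ z) + recipCauchyTransform μ₂ z
        - recipCauchyTransform ν₂ z

/-- The probability measure `μ₁ ▷_{ν₂} μ₂`, as the one singled out by `IsCMonotoneConv`
(an unspecified probability measure if there were none). -/
def cMonotoneConv (μ₁ ν₂ μ₂ : ProbabilityMeasure ℝ) : ProbabilityMeasure ℝ :=
  Classical.epsilon (IsCMonotoneConv μ₁ ν₂ μ₂)

/-- The deformed convolution `μ ▷_T ν`, i.e. the left component of `(μ, T μ) ▷ (ν, T ν)`. -/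
def deformedConv (T : ProbabilityMeasure ℝ → ProbabilityMeasure ℝ) (μ ν : ProbabilityMeasure ℝ) :
    ProbabilityMeasure ℝ :=
  cMonotoneConv μ (T ν) ν

/-- Probability measures on `ℝ` whose support is contained in `[0, ∞)`. -/
def positiveMeasures : Set (ProbabilityMeasure ℝ) :=
  {μ | (μ : Measure ℝ).support ⊆ Set.Ici 0}

/-- Symmetric probability measures on `ℝ`: invariant under `x ↦ -x`. -/
def symmetricMeasures : Set (ProbabilityMeasure ℝ) :=
  {μ | (μ : Measure ℝ).map (fun x : ℝ => -x) = (μ : Measure ℝ)}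

end

open Complex Filter Topology

/-! Work on the upper half-plane; conjugation gives the lower one. There `Im H_μ(z) ≥ Im z`, and
`H_μ(z) / z → 1` as `z → ∞` nontangentially. Put `w = H_{Tν}(z)`. The right-hand side of the
defining equation is `F(z) = (H_μ(w) - w) + H_ν(z)`: the bracket has nonnegative imaginary part, so
`Im F(z) ≥ Im z`, and `F(it) / (it) → 1`. Nevanlinna's theorem (`exists_cauchyTransform_eq`, deduced
from Herglotz' theorem on the disc) then makes `1 / F` a Cauchy transform. Uniqueness is Stieltjes
inversion (`eq_of_cauchyTransform_eq`).

Both equivalences are read off from `H`. Symmetry of a measure means that `H` is odd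
(`mem_symmetricMeasures_iff`), and support in `[0, ∞)` means `Im (H(z) / z) ≥ 0`, that is `arg z ≤
arg H(z)` (`mem_positiveMeasures_iff`). Each property passes through the formula for `F`, the second
because arguments only increase along `z`, `w`, `H_μ(w) - w`.

For the converses, `μ` is chosen so that `H_μ(w) - w` reveals `w`. The symmetric Bernoulli measure
gives `-1 / w`. The measures with mass `1 / N` at `0` and the rest at `N ^ 2` satisfy `(H_μ(w) - w)
/ N → w`, while `H_ν(z) / N → 0`, so the closed condition on `F(z) / z` survives in the limit for `w
/ z`. -/

/-! ### Elementary bounds for Cauchy transforms and their reciprocals -/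

lemma sub_ofReal_ne_zero_of_im_ne_zero {z : ℂ} (hz : z.im ≠ 0) (x : ℝ) : z - (x : ℂ) ≠ 0 := by
  intro h
  apply hz
  simpa using congrArg Complex.im h

lemma norm_one_div_sub_ofReal_le {z : ℂ} (hz : z.im ≠ 0) (x : ℝ) :
    ‖1 / (z - (x : ℂ))‖ ≤ 1 / |z.im| := by
  rw [norm_div, norm_one]
  apply one_div_le_one_div_of_le (abs_pos.mpr hz)
  simpa using abs_im_le_norm (z - (x : ℂ))

lemma measurable_one_div_sub_ofReal (z : ℂ) : Measurable fun x : ℝ => 1 / (z - (x : ℂ)) := by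
  fun_prop

lemma integrable_one_div_sub_ofReal (μ : Measure ℝ) [IsFiniteMeasure μ] {z : ℂ} (hz : z.im ≠ 0) :
    Integrable (fun x : ℝ => 1 / (z - (x : ℂ))) μ :=
  Integrable.of_bound (measurable_one_div_sub_ofReal z).aestronglyMeasurable (1 / |z.im|)
    (ae_of_all _ (norm_one_div_sub_ofReal_le hz))

/-- Inversion maps the horizontal line at height `Im z` into the circle through `0` with centre `-i
/ (2 Im z)`. The disc it bounds is convex, so the average `G_μ(z)` lies in it. -/
lemma norm_sub_center_one_div_sub_ofReal {z : ℂ} (hz : 0 < z.im) (x : ℝ) :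
    ‖1 / (z - (x : ℂ)) + I / (2 * z.im)‖ = 1 / (2 * z.im) := by
  have h0 := sub_ofReal_ne_zero_of_im_ne_zero hz.ne' x
  have hy : (z.im : ℂ) ≠ 0 := by exact_mod_cast hz.ne'
  have h1 : 1 / (z - (x : ℂ)) + I / (2 * z.im)
      = I * (starRingEnd ℂ (z - x)) / ((z - x) * (2 * z.im)) := by
    have h2 : starRingEnd ℂ (z - x) = (z - x) - 2 * z.im * I := by
      apply Complex.ext <;> simp
      ring
    rw [h2]
    field_simp
    linear_combination (2 * (z.im : ℂ)) * I_sq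
  rw [h1, norm_div, norm_mul, norm_mul, RCLike.norm_conj, norm_I, one_mul]
  have h3 : ‖(2 * z.im : ℂ)‖ = 2 * z.im := by
    rw [norm_mul, Complex.norm_real, Real.norm_of_nonneg hz.le]; simp
  rw [h3]
  have := norm_ne_zero_iff.mpr h0
  field_simp

lemma norm_cauchyTransform_add_le (μ : ProbabilityMeasure ℝ) {z : ℂ} (hz : 0 < z.im) :
    ‖cauchyTransform μ z + I / (2 * z.im)‖ ≤ 1 / (2 * z.im) := by
  have h : cauchyTransform μ z + I / (2 * z.im)
      = ∫ x : ℝ, (1 / (z - (x : ℂ)) + I / (2 * z.im)) ∂(μ : Measure ℝ) := by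
    rw [integral_add (integrable_one_div_sub_ofReal _ hz.ne') (integrable_const _)]
    simp [cauchyTransform]
  rw [h]
  refine (norm_integral_le_of_norm_le_const
    (ae_of_all _ fun x => (norm_sub_center_one_div_sub_ofReal hz x).le)).trans ?_
  simp

lemma cauchyTransform_conj (μ : ProbabilityMeasure ℝ) (z : ℂ) :
    cauchyTransform μ (starRingEnd ℂ z) = starRingEnd ℂ (cauchyTransform μ z) := by
  unfold cauchyTransform
  rw [← integral_conj]
  simp

lemma recipCauchyTransform_conj (μ : ProbabilityMeasure ℝ) (z : ℂ) :
    recipCauchyTransform μ (starRingEnd ℂ z) = starRingEnd ℂ (recipCauchyTransform μ z) := by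
  simp [recipCauchyTransform, cauchyTransform_conj]

/-- This is the disc estimate with the square expanded. Division by `|G|²` turns it into `Im z ≤ Im
H(z)`. -/
lemma im_mul_normSq_cauchyTransform_le (μ : ProbabilityMeasure ℝ) {z : ℂ} (hz : 0 < z.im) :
    z.im * normSq (cauchyTransform μ z) ≤ -(cauchyTransform μ z).im := by
  have h := norm_cauchyTransform_add_le μ hz
  have h2 := pow_le_pow_left₀ (norm_nonneg _) h 2
  rw [← normSq_eq_norm_sq] at h2
  have h3 : I / (2 * z.im : ℂ) = ((1 / (2 * z.im) : ℝ) : ℂ) * I := by push_cast; ring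
  rw [h3, normSq_apply] at h2
  simp at h2
  rw [normSq_apply]
  set G := cauchyTransform μ z
  have h4 : z.im * (z.im⁻¹ * 2⁻¹) = 2⁻¹ := by field_simp
  have h5 : G.re * G.re + G.im * G.im + 2 * G.im * (z.im⁻¹ * 2⁻¹) ≤ 0 := by
    have h6 : ((2 * z.im)^2)⁻¹ = (z.im⁻¹ * 2⁻¹)^2 := by field_simp
    nlinarith
  have h7 := mul_le_mul_of_nonneg_left h5 hz.le
  linear_combination h7 - 2 * G.im * h4

lemma im_cauchyTransform_neg (μ : ProbabilityMeasure ℝ) {z : ℂ} (hz : 0 < z.im) :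
    (cauchyTransform μ z).im < 0 := by
  have e : ∀ x : ℝ, (1 / (z - (x : ℂ))).im < 0 := fun x => by
    have := normSq_pos.mpr (sub_ofReal_ne_zero_of_im_ne_zero hz.ne' x)
    simp only [one_div, inv_im, sub_im, ofReal_im, sub_zero]
    exact div_neg_of_neg_of_pos (by linarith) this
  have hi := (integrable_one_div_sub_ofReal (μ : Measure ℝ) hz.ne').im
  have h1 : (cauchyTransform μ z).im = ∫ x : ℝ, (1 / (z - (x : ℂ))).im ∂(μ : Measure ℝ) :=
    (integral_im (integrable_one_div_sub_ofReal _ hz.ne')).symm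
  rw [h1]
  have h2 : 0 < ∫ x : ℝ, -(1 / (z - (x : ℂ))).im ∂(μ : Measure ℝ) := by
    refine (integral_pos_iff_support_of_nonneg (fun x => by simpa using (e x).le)
      (show Integrable (fun x : ℝ => -(1 / (z - (x : ℂ))).im) (μ : Measure ℝ) from hi.neg)).mpr ?_
    have : Function.support (fun x : ℝ => -(1 / (z - (x : ℂ))).im) = Set.univ := by
      ext x; simpa using (e x).ne
    rw [this]; simp
  rw [integral_neg] at h2
  linarith

lemma cauchyTransform_ne_zero (μ : ProbabilityMeasure ℝ) {z : ℂ} (hz : z.im ≠ 0) :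
    cauchyTransform μ z ≠ 0 := by
  intro h
  rcases lt_or_gt_of_ne hz with h' | h'
  · have := im_cauchyTransform_neg μ (z := starRingEnd ℂ z) (by simpa using h')
    simp [cauchyTransform_conj, h] at this
  · have := im_cauchyTransform_neg μ h'
    simp [h] at this

lemma im_le_im_recipCauchyTransform (μ : ProbabilityMeasure ℝ) {z : ℂ} (hz : 0 < z.im) :
    z.im ≤ (recipCauchyTransform μ z).im := by
  have h := im_mul_normSq_cauchyTransform_le μ hz
  have h0 := normSq_pos.mpr (cauchyTransform_ne_zero μ hz.ne')
  rw [recipCauchyTransform, one_div, inv_im, le_div_iff₀ h0]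
  exact h

lemma im_recipCauchyTransform_pos (μ : ProbabilityMeasure ℝ) {z : ℂ} (hz : 0 < z.im) :
    0 < (recipCauchyTransform μ z).im := hz.trans_le (im_le_im_recipCauchyTransform μ hz)

lemma im_recipCauchyTransform_ne_zero (μ : ProbabilityMeasure ℝ) {z : ℂ} (hz : z.im ≠ 0) :
    (recipCauchyTransform μ z).im ≠ 0 := by
  rcases lt_or_gt_of_ne hz with h' | h'
  · have := im_recipCauchyTransform_pos μ (z := starRingEnd ℂ z) (by simpa using h')
    rw [recipCauchyTransform_conj, conj_im] at this
    linarith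
  · exact (im_recipCauchyTransform_pos μ h').ne'

/-! ### Holomorphy and behaviour at infinity -/

/-- The Cauchy integral of a finite measure is holomorphic on the upper half-plane. -/
lemma differentiableOn_integral_one_div_sub (μ : Measure ℝ) [IsFiniteMeasure μ] :
    DifferentiableOn ℂ (fun z : ℂ => ∫ x : ℝ, 1 / (z - (x : ℂ)) ∂μ) {z | 0 < z.im} := by
  intro z hz
  have hz : 0 < z.im := hz
  -- Staying above half the height of `z` bounds the derivative of the kernel uniformly.
  set U : Set ℂ := {w | z.im / 2 < w.im}
  have hU : U ∈ 𝓝 z :=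
    (isOpen_lt continuous_const continuous_im).mem_nhds (by simp; linarith)
  have key := hasDerivAt_integral_of_dominated_loc_of_deriv_le (μ := μ)
    (F := fun (w : ℂ) (x : ℝ) => 1 / (w - (x : ℂ)))
    (F' := fun (w : ℂ) (x : ℝ) => -(1 / (w - (x : ℂ))) ^ 2) (x₀ := z)
    (bound := fun _ => (1 / (z.im / 2)) ^ 2) hU
    (Eventually.of_forall fun w => (measurable_one_div_sub_ofReal w).aestronglyMeasurable)
    (integrable_one_div_sub_ofReal μ hz.ne')
    (((measurable_one_div_sub_ofReal z).pow_const 2).neg.aestronglyMeasurable)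
    (ae_of_all _ fun x w hw => ?_) (integrable_const _)
    (ae_of_all _ fun x w hw => ?_)
  · exact key.2.differentiableAt.differentiableWithinAt
  · have hw : z.im / 2 < w.im := hw
    have hw0 : 0 < w.im := by linarith
    rw [norm_neg, norm_pow]
    gcongr
    refine (norm_one_div_sub_ofReal_le hw0.ne' x).trans ?_
    rw [abs_of_pos hw0]
    gcongr
  · have hw : z.im / 2 < w.im := hw
    have hw0 : 0 < w.im := by linarith
    have h0 := sub_ofReal_ne_zero_of_im_ne_zero hw0.ne' x
    have := ((hasDerivAt_id w).sub_const (x : ℂ)).inv h0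
    convert! this using 1
    · ext; simp
    · simp; field_simp

lemma differentiableOn_cauchyTransform (μ : ProbabilityMeasure ℝ) :
    DifferentiableOn ℂ (cauchyTransform μ) {z | 0 < z.im} :=
  differentiableOn_integral_one_div_sub (μ : Measure ℝ)

lemma differentiableOn_recipCauchyTransform (μ : ProbabilityMeasure ℝ) :
    DifferentiableOn ℂ (recipCauchyTransform μ) {z | 0 < z.im} :=
  (differentiableOn_const 1).div (differentiableOn_cauchyTransform μ)
    fun _ hz => cauchyTransform_ne_zero μ (ne_of_gt hz)

/-- Along nontangential approach to infinity, `w G(w)` tends to the total mass. -/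
lemma tendsto_mul_integral_one_div_sub {ι : Type*} {l : Filter ι} [l.IsCountablyGenerated]
    (μ : Measure ℝ) [IsFiniteMeasure μ] {w : ι → ℂ} {C : ℝ}
    (hw : ∀ᶠ i in l, ‖w i‖ ≤ C * (w i).im) (hw' : Tendsto (fun i => (w i).im) l atTop) :
    Tendsto (fun i => w i * ∫ x : ℝ, 1 / (w i - (x : ℂ)) ∂μ) l (𝓝 (μ.real Set.univ)) := by
  have e : ((μ.real Set.univ : ℝ) : ℂ) = ∫ _ : ℝ, (1 : ℂ) ∂μ := by simp
  rw [e]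
  simp_rw [← integral_const_mul]
  refine tendsto_integral_filter_of_dominated_convergence (fun _ => C)
    (Eventually.of_forall fun i =>
      ((measurable_one_div_sub_ofReal (w i)).const_mul _).aestronglyMeasurable)
    ?_ (integrable_const _) (ae_of_all _ fun x => ?_)
  · filter_upwards [hw, hw'.eventually_gt_atTop 0] with i hi hp
    refine ae_of_all _ fun x => ?_
    rw [norm_mul]
    have := norm_one_div_sub_ofReal_le hp.ne' x
    rw [abs_of_pos hp] at this
    calc ‖w i‖ * ‖1 / (w i - (x : ℂ))‖ ≤ (C * (w i).im) * (1 / (w i).im) := by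
          gcongr
          exact (norm_nonneg _).trans hi
      _ = C := by field_simp
  · have h1 : Tendsto (fun i => 1 / (w i - (x : ℂ))) l (𝓝 0) := by
      rw [tendsto_zero_iff_norm_tendsto_zero]
      refine squeeze_zero' (Eventually.of_forall fun _ => norm_nonneg _) ?_
        (hw'.inv_tendsto_atTop)
      filter_upwards [hw'.eventually_gt_atTop 0] with i hp
      have := norm_one_div_sub_ofReal_le hp.ne' x
      rw [abs_of_pos hp] at this
      simpa using this
    -- Pointwise limit from `w / (w - x) = 1 + x / (w - x)`; the nontangential bound `C` dominates.
    have h2 : Tendsto (fun i => 1 + (x : ℂ) * (1 / (w i - (x : ℂ)))) l (𝓝 (1 + x * 0)) :=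
      tendsto_const_nhds.add (h1.const_mul _)
    rw [mul_zero, add_zero] at h2
    refine h2.congr' ?_
    filter_upwards [hw'.eventually_gt_atTop 0] with i hp
    have h0 := sub_ofReal_ne_zero_of_im_ne_zero hp.ne' x
    field_simp
    ring

lemma tendsto_recipCauchyTransform_div {ι : Type*} {l : Filter ι} [l.IsCountablyGenerated]
    (μ : ProbabilityMeasure ℝ) {w : ι → ℂ} {C : ℝ}
    (hw : ∀ᶠ i in l, ‖w i‖ ≤ C * (w i).im) (hw' : Tendsto (fun i => (w i).im) l atTop) :
    Tendsto (fun i => recipCauchyTransform μ (w i) / w i) l (𝓝 1) := by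
  have h := (tendsto_mul_integral_one_div_sub (μ : Measure ℝ) hw hw').inv₀ (by simp)
  simp only [probReal_univ, ofReal_one, inv_one] at h
  refine h.congr fun i => ?_
  rw [mul_inv, recipCauchyTransform, cauchyTransform]
  ring

/-! ### Poisson integrals, Stieltjes inversion and uniqueness -/

lemma im_one_div_sub_ofReal (z : ℂ) (x : ℝ) :
    (1 / (z - (x : ℂ))).im = -(z.im / ((z.re - x) ^ 2 + z.im ^ 2)) := by
  simp [normSq_apply, sq, neg_div]

/-- The imaginary part of a Cauchy integral is minus the Poisson integral. -/
lemma im_integral_one_div_sub (μ : Measure ℝ) [IsFiniteMeasure μ] {z : ℂ} (hz : z.im ≠ 0) :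
    (∫ x : ℝ, 1 / (z - (x : ℂ)) ∂μ).im = -∫ x : ℝ, z.im / ((z.re - x) ^ 2 + z.im ^ 2) ∂μ := by
  rw [← integral_neg]
  simp_rw [← im_one_div_sub_ofReal]
  exact (integral_im (integrable_one_div_sub_ofReal μ hz)).symm

lemma integrable_poissonKernel (x : ℝ) {y : ℝ} (hy : 0 < y) :
    Integrable (fun u : ℝ => y / ((u - x) ^ 2 + y ^ 2)) := by
  have h := ((integrable_inv_one_add_sq.comp_div hy.ne').comp_sub_right x).const_mul y⁻¹
  refine h.congr (ae_of_all _ fun u => ?_)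
  field_simp
  ring

/-- The substitution `u = x + y s` moves `y` from the kernel into the test function, so that `y → 0`
becomes dominated convergence against a fixed weight. -/
lemma integral_mul_poissonKernel (ψ : ℝ → ℝ) (x : ℝ) {y : ℝ} (hy : 0 < y) :
    ∫ u : ℝ, ψ u * (y / ((u - x) ^ 2 + y ^ 2)) = ∫ s : ℝ, ψ (x + y * s) * (1 + s ^ 2)⁻¹ := by
  have h1 := integral_add_left_eq_self (μ := volume)
    (fun u : ℝ => ψ u * (y / ((u - x) ^ 2 + y ^ 2))) x
  have h2 := Measure.integral_comp_mul_left
    (fun u : ℝ => ψ (x + u) * (y / ((x + u - x) ^ 2 + y ^ 2))) y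
  rw [h1, abs_of_pos (inv_pos.mpr hy), smul_eq_mul] at h2
  rw [← mul_right_inj' (inv_ne_zero hy.ne'), ← h2, ← integral_const_mul]
  congr 1
  ext s
  field_simp
  ring

lemma integral_poissonKernel (x : ℝ) {y : ℝ} (hy : 0 < y) :
    ∫ u : ℝ, y / ((u - x) ^ 2 + y ^ 2) = Real.pi := by
  have := integral_mul_poissonKernel (fun _ => 1) x hy
  simpa using this

lemma integrable_poissonKernel_prod (μ : Measure ℝ) [IsFiniteMeasure μ] {y : ℝ} (hy : 0 < y) :
    Integrable (fun p : ℝ × ℝ => y / ((p.2 - p.1) ^ 2 + y ^ 2)) (μ.prod volume) := by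
  have hm : Measurable fun p : ℝ × ℝ => y / ((p.2 - p.1) ^ 2 + y ^ 2) := by fun_prop
  rw [integrable_prod_iff hm.aestronglyMeasurable]
  refine ⟨ae_of_all _ fun x => integrable_poissonKernel x hy, ?_⟩
  have : ∀ x : ℝ, ∫ u : ℝ, ‖y / ((u - x) ^ 2 + y ^ 2)‖ = Real.pi := fun x => by
    rw [← integral_poissonKernel x hy]
    congr 1
    ext u
    exact Real.norm_of_nonneg (by positivity)
  simp only [this]
  exact integrable_const _

/-- **Stieltjes inversion**, in the weak form. -/
lemma tendsto_integral_mul_poissonIntegral (μ : Measure ℝ) [IsFiniteMeasure μ]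
    (ψ : BoundedContinuousFunction ℝ ℝ) {y : ℕ → ℝ} (hy : ∀ n, 0 < y n)
    (hy0 : Tendsto y atTop (𝓝 0)) :
    Tendsto (fun n => ∫ u : ℝ, ψ u * ∫ x : ℝ, y n / ((u - x) ^ 2 + y n ^ 2) ∂μ) atTop
      (𝓝 (Real.pi * ∫ x, ψ x ∂μ)) := by
  have swap : ∀ n, ∫ u : ℝ, ψ u * ∫ x : ℝ, y n / ((u - x) ^ 2 + y n ^ 2) ∂μ
      = ∫ x : ℝ, (∫ s : ℝ, ψ (x + y n * s) * (1 + s ^ 2)⁻¹) ∂μ := fun n => by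
    have hi : Integrable (fun p : ℝ × ℝ => ψ p.2 * (y n / ((p.2 - p.1) ^ 2 + y n ^ 2)))
        (μ.prod volume) :=
      (integrable_poissonKernel_prod μ (hy n)).bdd_mul (c := ‖ψ‖)
        (ψ.continuous.comp continuous_snd).aestronglyMeasurable
        (ae_of_all _ fun p => ψ.norm_coe_le_norm p.2)
    simp_rw [← integral_mul_poissonKernel ψ _ (hy n), ← integral_const_mul]
    exact (integral_integral_swap hi).symm
  simp_rw [swap]
  rw [← integral_const_mul]
  have bd : ∀ (n : ℕ) (x s : ℝ), ‖ψ (x + y n * s) * (1 + s ^ 2)⁻¹‖ ≤ ‖ψ‖ * (1 + s ^ 2)⁻¹ :=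
    fun n x s => by
      rw [norm_mul, Real.norm_of_nonneg (show 0 ≤ (1 + s ^ 2)⁻¹ by positivity)]
      exact mul_le_mul_of_nonneg_right (ψ.norm_coe_le_norm _) (by positivity)
  refine tendsto_integral_of_dominated_convergence (fun _ => ‖ψ‖ * Real.pi)
    (fun n => ?_) (integrable_const _) (fun n => ae_of_all _ fun x => ?_)
    (ae_of_all _ fun x => ?_)
  · have hc : Continuous fun p : ℝ × ℝ => ψ (p.1 + y n * p.2) * (1 + p.2 ^ 2)⁻¹ := by
      refine (ψ.continuous.comp (by fun_prop)).mul
        (Continuous.inv₀ (by fun_prop) fun p => by positivity)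
    exact (hc.stronglyMeasurable.integral_prod_right' (ν := volume)).aestronglyMeasurable
  · rw [← integral_univ_inv_one_add_sq, ← integral_const_mul]
    exact norm_integral_le_of_norm_le (integrable_inv_one_add_sq.const_mul _)
      (ae_of_all _ fun s => bd n x s)
  · have e : Real.pi * ψ x = ∫ s : ℝ, ψ x * (1 + s ^ 2)⁻¹ := by
      rw [integral_const_mul, integral_univ_inv_one_add_sq, mul_comm]
    rw [e]
    refine tendsto_integral_of_dominated_convergence (fun s => ‖ψ‖ * (1 + s ^ 2)⁻¹)
      (fun n => ?_) (integrable_inv_one_add_sq.const_mul _) (fun n => ae_of_all _ fun s => bd n x s)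
      (ae_of_all _ fun s => ?_)
    · refine Continuous.aestronglyMeasurable ?_
      refine (ψ.continuous.comp (by fun_prop)).mul
        (Continuous.inv₀ (by fun_prop) fun p => by positivity)
    · refine Tendsto.mul_const _ ?_
      have : Tendsto (fun n => x + y n * s) atTop (𝓝 (x + 0 * s)) :=
        tendsto_const_nhds.add (hy0.mul_const s)
      rw [zero_mul, add_zero] at this
      exact (ψ.continuous.tendsto x).comp this

/-- A probability measure is determined by its Cauchy transform on the upper half-plane. -/
lemma eq_of_cauchyTransform_eq {μ ν : ProbabilityMeasure ℝ}
    (h : ∀ z : ℂ, 0 < z.im → cauchyTransform μ z = cauchyTransform ν z) : μ = ν := by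
  refine Subtype.ext (show (μ : Measure ℝ) = (ν : Measure ℝ) from ?_)
  refine ext_of_forall_integral_eq_of_IsFiniteMeasure fun ψ => ?_
  have hy : ∀ n : ℕ, 0 < 1 / ((n : ℝ) + 1) := fun n => by positivity
  have h1 := tendsto_integral_mul_poissonIntegral (μ : Measure ℝ) ψ hy
    tendsto_one_div_add_atTop_nhds_zero_nat
  have h2 := tendsto_integral_mul_poissonIntegral (ν : Measure ℝ) ψ hy
    tendsto_one_div_add_atTop_nhds_zero_nat
  refine mul_left_cancel₀ Real.pi_ne_zero (tendsto_nhds_unique h1 (h2.congr fun n => ?_))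
  congr 1
  ext u
  congr 1
  set z : ℂ := ⟨u, 1 / ((n : ℝ) + 1)⟩
  have hz := congrArg Complex.im (h z (hy n))
  rw [cauchyTransform, cauchyTransform, im_integral_one_div_sub _ (hy n).ne',
    im_integral_one_div_sub _ (hy n).ne'] at hz
  exact (neg_injective hz).symm

lemma eq_of_recipCauchyTransform_eq {μ ν : ProbabilityMeasure ℝ}
    (h : ∀ z : ℂ, 0 < z.im → recipCauchyTransform μ z = recipCauchyTransform ν z) : μ = ν :=
  eq_of_cauchyTransform_eq fun z hz => by simpa [recipCauchyTransform] using h z hz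

/-! ### Herglotz' theorem on the disc -/

/-- The point of the unit circle with a given argument. -/
noncomputable def unitCirclePoint (θ : ℝ) : Metric.sphere (0 : ℂ) 1 :=
  ⟨circleMap 0 1 θ, circleMap_mem_sphere 0 zero_le_one θ⟩

lemma continuous_unitCirclePoint : Continuous unitCirclePoint :=
  (continuous_circleMap 0 1).subtype_mk _

/-- The normalized arc length measure on the unit circle. -/
noncomputable def circleArcMeasure : Measure (Metric.sphere (0 : ℂ) 1) :=
  ENNReal.ofReal (2 * Real.pi)⁻¹ •
    (volume.restrict (Set.Ioc 0 (2 * Real.pi))).map unitCirclePoint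

lemma integral_circleArcMeasure {h : ℂ → ℝ} (hc : Continuous fun e : Metric.sphere (0 : ℂ) 1 => h e) :
    ∫ e : Metric.sphere (0 : ℂ) 1, h e ∂circleArcMeasure = Real.circleAverage h 0 1 := by
  have hpi : 0 ≤ 2 * Real.pi := by positivity
  rw [circleArcMeasure, integral_smul_measure,
    integral_map continuous_unitCirclePoint.aemeasurable hc.aestronglyMeasurable,
    Real.circleAverage_def, intervalIntegral.integral_of_le hpi,
    ENNReal.toReal_ofReal (by positivity)]
  simp [unitCirclePoint]

instance : IsProbabilityMeasure circleArcMeasure := by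
  constructor
  rw [circleArcMeasure, Measure.smul_apply,
    Measure.map_apply continuous_unitCirclePoint.measurable MeasurableSet.univ]
  simp only [Set.preimage_univ, Measure.restrict_apply_univ, Real.volume_Ioc, sub_zero,
    smul_eq_mul]
  rw [← ENNReal.ofReal_mul (by positivity), inv_mul_cancel₀ (by positivity), ENNReal.ofReal_one]

lemma continuous_poissonKernel_circle {w : ℂ} (hw : ‖w‖ < 1) :
    Continuous fun e : Metric.sphere (0 : ℂ) 1 => poissonKernel 0 w e := by
  simp only [poissonKernel_def, sub_zero]
  refine Continuous.div (by fun_prop) (by fun_prop) fun e => ?_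
  have : (e : ℂ) - w ≠ 0 := by
    intro h
    have := sub_eq_zero.mp h
    rw [← this] at hw
    simp at hw
  positivity

/-- Poisson's formula on a smaller circle, for the real part of a holomorphic function. -/
lemma re_mul_eq_circleAverage {f : ℂ → ℂ} (hf : DifferentiableOn ℂ f (Metric.ball 0 1))
    {r : ℝ} (hr0 : 0 < r) (hr1 : r < 1) {w : ℂ} (hw : ‖w‖ < 1) :
    (f (r * w)).re = Real.circleAverage (fun e => poissonKernel 0 w e * (f (r * e)).re) 0 1 := by
  have maps : Set.MapsTo (fun z : ℂ => (r : ℂ) * z) (Metric.closedBall 0 1) (Metric.ball 0 1) := by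
    intro z hz
    simp only [mem_closedBall_zero_iff, mem_ball_zero_iff, norm_mul, Complex.norm_real,
      Real.norm_of_nonneg hr0.le] at hz ⊢
    nlinarith [norm_nonneg z]
  have hd : DifferentiableOn ℂ (fun z => f (r * z)) (Metric.closedBall 0 1) :=
    hf.comp (by fun_prop) maps
  have hdc : DiffContOnCl ℂ (fun z => f (r * z)) (Metric.ball 0 1) :=
    DifferentiableOn.diffContOnCl (by rwa [closure_ball 0 one_ne_zero])
  have key := hdc.circleAverage_poissonKernel_smul (w := w) (by simpa using hw)
  have hsub : Metric.sphere (0 : ℂ) 1 ⊆ Metric.closedBall 0 1 := Metric.sphere_subset_closedBall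
  have hci : CircleIntegrable (poissonKernel 0 w • fun z => f (r * z)) 0 1 := by
    apply ContinuousOn.circleIntegrable zero_le_one
    refine ContinuousOn.smul ?_ (hd.continuousOn.mono hsub)
    simp only [poissonKernel_eq_re_herglotzRieszKernel]
    refine continuous_re.comp_continuousOn ?_
    simpa using continuousOn_herglotzRieszKernel_sphere (c := 0) (R := 1) (w := w) (by simpa using hw)
  have := reCLM.circleAverage_comp_comm hci
  rw [key] at this
  simp only [reCLM_apply] at this
  rw [← this]
  congr 1
  ext z
  simp

/-- **Herglotz' theorem**, for real parts. -/
lemma exists_measure_re_eq_integral_poissonKernel {f : ℂ → ℂ}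
    (hf : DifferentiableOn ℂ f (Metric.ball 0 1))
    (hpos : ∀ w : ℂ, ‖w‖ < 1 → 0 ≤ (f w).re) (h0 : 0 < (f 0).re) :
    ∃ σ : ProbabilityMeasure (Metric.sphere (0 : ℂ) 1), ∀ w : ℂ, ‖w‖ < 1 →
      (f w).re = (f 0).re * ∫ e : Metric.sphere (0 : ℂ) 1, poissonKernel 0 w e ∂(σ : Measure (Metric.sphere (0 : ℂ) 1)) := by
  set c := (f 0).re
  -- The shift by `2` keeps the radius positive at `n = 0`.
  set r : ℕ → ℝ := fun n => 1 - 1 / ((n : ℝ) + 2)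
  have hr0 : ∀ n, 0 < r n := fun n => by
    have : (0 : ℝ) < n + 2 := by positivity
    have : 1 / ((n : ℝ) + 2) < 1 := by
      rw [div_lt_one this]; linarith [(Nat.cast_nonneg n : (0 : ℝ) ≤ n)]
    simp only [r]; linarith
  have hr1 : ∀ n, r n < 1 := fun n => by
    have : 0 < 1 / ((n : ℝ) + 2) := by positivity
    simp only [r]; linarith
  have hrt : Tendsto r atTop (𝓝 1) := by
    have h1 : Tendsto (fun n : ℕ => 1 / ((n : ℝ) + 2)) atTop (𝓝 0) := by
      have := (tendsto_natCast_atTop_atTop (R := ℝ)).atTop_add (tendsto_const_nhds (x := (2 : ℝ)))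
      simpa [Pi.inv_def] using this.inv_tendsto_atTop
    simpa [r] using tendsto_const_nhds.sub h1
  have hball : ∀ n (w : ℂ), ‖w‖ ≤ 1 → ‖(r n : ℂ) * w‖ < 1 := fun n w hw => by
    rw [norm_mul, Complex.norm_real, Real.norm_of_nonneg (hr0 n).le]
    nlinarith [norm_nonneg w, hr0 n, hr1 n]
  have hcont : ∀ n, Continuous fun e : Metric.sphere (0 : ℂ) 1 => (f (r n * e)).re := fun n => by
    refine continuous_re.comp (hf.continuousOn.comp_continuous (by fun_prop) fun e => ?_)
    simpa using hball n e (by simp)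
  have hD : ∀ n (e : Metric.sphere (0 : ℂ) 1), 0 ≤ (f (r n * e)).re / c := fun n e =>
    div_nonneg (hpos _ (hball n e (by simp))) h0.le
  let D : ℕ → Metric.sphere (0 : ℂ) 1 → ENNReal := fun n e => ENNReal.ofReal ((f (r n * e)).re / c)
  have hDm : ∀ n, Measurable (D n) := fun n =>
    ENNReal.measurable_ofReal.comp ((hcont n).measurable.div_const c)
  have hint : ∀ n (w : ℂ), ‖w‖ < 1 →
      ∫ e : Metric.sphere (0 : ℂ) 1, poissonKernel 0 w e ∂(circleArcMeasure.withDensity (D n))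
        = (f (r n * w)).re / c := fun n w hw => by
    rw [integral_withDensity_eq_integral_toReal_smul (hDm n)
      (ae_of_all _ fun e => ENNReal.ofReal_lt_top), re_mul_eq_circleAverage hf (hr0 n) (hr1 n) hw,
      ← integral_circleArcMeasure ((continuous_poissonKernel_circle hw).mul (hcont n)),
      ← integral_div]
    congr 1
    ext e
    rw [ENNReal.toReal_ofReal (hD n e), smul_eq_mul]
    ring
  have hprob : ∀ n, IsProbabilityMeasure (circleArcMeasure.withDensity (D n)) := fun n => by
    constructor
    have hfin : circleArcMeasure.withDensity (D n) Set.univ ≠ ⊤ := by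
      rw [withDensity_apply _ MeasurableSet.univ, Measure.restrict_univ]
      have hi : Integrable (fun e : Metric.sphere (0 : ℂ) 1 => (f (r n * e)).re / c)
          circleArcMeasure :=
        ((hcont n).div_const c).integrable_of_hasCompactSupport (HasCompactSupport.of_compactSpace _)
      exact hi.lintegral_lt_top.ne
    -- At `w = 0` the Poisson kernel is `1`, so the formula computes the total mass.
    have h1 := hint n 0 (by simp)
    simp only [poissonKernel_def, sub_zero, norm_zero, norm_eq_of_mem_sphere, mul_zero] at h1
    rw [div_self h0.ne'] at h1
    simp at h1
    rw [← ENNReal.ofReal_toReal hfin]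
    simpa [Measure.real] using h1
  let σ : ℕ → ProbabilityMeasure (Metric.sphere (0 : ℂ) 1) := fun n => ⟨_, hprob n⟩
  -- Probability measures on the circle form a compact space; a limit along an ultrafilter spares
  -- extracting a subsequence.
  obtain ⟨U, hU⟩ := Ultrafilter.exists_le (atTop : Filter ℕ)
  obtain ⟨s, -, hs⟩ := isCompact_univ.ultrafilter_le_nhds (U.map σ) (by simp)
  have hs : Tendsto σ U (𝓝 s) := hs
  refine ⟨s, fun w hw => ?_⟩
  have h1 := (ProbabilityMeasure.tendsto_iff_forall_integral_tendsto.mp hs)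
    (BoundedContinuousFunction.mkOfCompact ⟨_, continuous_poissonKernel_circle hw⟩)
  have h2 : Tendsto (fun n => (f (r n * w)).re / c) U (𝓝 ((f w).re / c)) := by
    have hrw : Tendsto (fun n => (r n : ℂ) * w) U (𝓝 ((1 : ℝ) * w)) :=
      ((continuous_ofReal.tendsto 1).comp (hrt.mono_left hU)).mul_const w
    rw [ofReal_one, one_mul] at hrw
    have hfw : ContinuousAt f w :=
      hf.continuousOn.continuousAt (Metric.isOpen_ball.mem_nhds (by simpa using hw))
    exact ((continuous_re.tendsto _).comp (hfw.tendsto.comp hrw)).div_const c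
  have h3 := tendsto_nhds_unique (h1.congr fun n => hint n w hw) h2
  simp only [BoundedContinuousFunction.mkOfCompact_apply, ContinuousMap.coe_mk] at h3
  rw [h3]
  field_simp

/-! ### Transport to the half-plane and Nevanlinna's theorem -/

/-- The real point corresponding to a point `e ≠ 1` of the unit circle under the Cayley
transform. -/
noncomputable def cayleyReal (e : ℂ) : ℝ := -e.im / (1 - e.re)

lemma re_lt_one_of_mem_sphere {e : ℂ} (he : ‖e‖ = 1) (h1 : e ≠ 1) : e.re < 1 := by
  have h : e.re ^ 2 + e.im ^ 2 = 1 := by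
    have := normSq_eq_norm_sq e
    rw [he, normSq_apply] at this
    linarith
  by_contra! hre
  apply h1
  have h2 : e.im ^ 2 = 0 := by nlinarith [sq_nonneg e.im]
  have h3 : e.im = 0 := by simpa using h2
  apply Complex.ext
  · simp; nlinarith
  · simpa using h3

lemma add_I_ne_zero {z : ℂ} (hz : 0 < z.im) : z + I ≠ 0 := by
  intro h
  have := congrArg Complex.im h
  simp at this
  linarith

lemma normSq_add_I_sub (z : ℂ) : normSq (z + I) - normSq (z - I) = 4 * z.im := by
  simp [normSq_apply]
  ring

lemma norm_cayley_lt_one {z : ℂ} (hz : 0 < z.im) : ‖(z - I) / (z + I)‖ < 1 := by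
  rw [norm_div, div_lt_one (norm_pos_iff.mpr (add_I_ne_zero hz))]
  have h := normSq_add_I_sub z
  rw [normSq_eq_norm_sq, normSq_eq_norm_sq] at h
  exact lt_of_pow_lt_pow_left₀ 2 (norm_nonneg _) (by linarith)

lemma poissonKernel_cayley {z e : ℂ} (hz : 0 < z.im) (he : ‖e‖ = 1) :
    poissonKernel 0 ((z - I) / (z + I)) e
      = 4 * z.im / normSq (e * (z + I) - (z - I)) := by
  have h0 := add_I_ne_zero hz
  have h1 : normSq (z + I) ≠ 0 := (normSq_pos.mpr h0).ne'
  have h2 : e - (z - I) / (z + I) = (e * (z + I) - (z - I)) / (z + I) := by field_simp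
  rw [poissonKernel_def, sub_zero, sub_zero, he, h2, ← normSq_eq_norm_sq, ← normSq_eq_norm_sq,
    map_div₀, map_div₀, ← normSq_add_I_sub]
  field_simp

lemma poissonKernel_cayley_one {z : ℂ} (hz : 0 < z.im) :
    poissonKernel 0 ((z - I) / (z + I)) 1 = z.im := by
  rw [poissonKernel_cayley hz (by simp)]
  have : (1 : ℂ) * (z + I) - (z - I) = 2 * I := by ring
  rw [this]
  simp [normSq_apply]
  ring

/-- The factor `1 + x ^ 2` is the density that converts the measure on the circle into the one on
the line. -/
lemma poissonKernel_cayley_of_ne_one {z e : ℂ} (hz : 0 < z.im) (he : ‖e‖ = 1) (h1 : e ≠ 1) :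
    poissonKernel 0 ((z - I) / (z + I)) e
      = (1 + cayleyReal e ^ 2) * (z.im / ((z.re - cayleyReal e) ^ 2 + z.im ^ 2)) := by
  rw [poissonKernel_cayley hz he]
  have hre := re_lt_one_of_mem_sphere he h1
  have h : e.re ^ 2 + e.im ^ 2 = 1 := by
    have := normSq_eq_norm_sq e
    rw [he, normSq_apply] at this
    linarith
  have ha : 1 - e.re ≠ 0 := by linarith
  set x := cayleyReal e with hx
  have hb : e.im = -x * (1 - e.re) := by rw [hx, cayleyReal]; field_simp
  have h3 : (1 + x ^ 2) * (1 - e.re) = 2 := by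
    rw [hb] at h
    apply mul_right_cancel₀ ha
    linear_combination h
  have h4 : normSq (e * (z + I) - (z - I))
      = 2 * (1 - e.re) * ((z.re - x) ^ 2 + z.im ^ 2) := by
    simp [normSq_apply]
    rw [hb]
    linear_combination ((1 - e.re) * (z.re ^ 2 + (z.im + 1) ^ 2) - 2) * h3
  have h5 : 0 < (z.re - x) ^ 2 + z.im ^ 2 := by positivity
  rw [h4, ← mul_div_assoc, div_eq_div_iff (by positivity) h5.ne']
  linear_combination (-2 * z.im * ((z.re - x) ^ 2 + z.im ^ 2)) * h3

lemma im_I_mul_ofReal_pos {t : ℝ} (ht : 0 < t) : 0 < (I * t : ℂ).im := by simpa using ht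

lemma eventually_norm_I_mul_le : ∀ᶠ t : ℝ in atTop, ‖(I * t : ℂ)‖ ≤ 1 * (I * t : ℂ).im := by
  filter_upwards [eventually_gt_atTop 0] with t ht
  simp [abs_of_pos ht]

lemma tendsto_im_I_mul_atTop : Tendsto (fun t : ℝ => (I * t : ℂ).im) atTop atTop :=
  tendsto_id.congr fun t => by simp

/-- If the Poisson integrals of a measure on the circle, transported to the half-plane, decay like
`1 / t` along the imaginary axis, then the measure has no atom at `1` and integrates
`1 + x ^ 2`. -/
lemma lintegral_one_add_cayleyReal_sq_le (σ : ProbabilityMeasure (Metric.sphere (0 : ℂ) 1))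
    {M : ℝ}
    (hM : ∀ t : ℝ, 0 < t →
      t * ∫ e : Metric.sphere (0 : ℂ) 1, poissonKernel 0 ((I * t - I) / (I * t + I)) e ∂
        (σ : Measure (Metric.sphere (0 : ℂ) 1)) ≤ M) :
    ∫⁻ e : Metric.sphere (0 : ℂ) 1,
      (if (e : ℂ) = 1 then ⊤ else ENNReal.ofReal (1 + cayleyReal e ^ 2))
      ∂(σ : Measure (Metric.sphere (0 : ℂ) 1)) ≤ ENNReal.ofReal M := by
  set P : ℕ → Metric.sphere (0 : ℂ) 1 → ℝ := fun n e =>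
    ((n : ℝ) + 1) * poissonKernel 0
      ((I * ((n : ℝ) + 1 : ℝ) - I) / (I * ((n : ℝ) + 1 : ℝ) + I)) e with hP
  have hn : ∀ n : ℕ, (0 : ℝ) < n + 1 := fun n => by positivity
  have hPc : ∀ n, Continuous (P n) := fun n =>
    continuous_const.mul (continuous_poissonKernel_circle
      (norm_cayley_lt_one (im_I_mul_ofReal_pos (hn n))))
  have hone : ∀ n (e : Metric.sphere (0 : ℂ) 1), (e : ℂ) = 1 → P n e = ((n : ℝ) + 1) ^ 2 :=
    fun n e he => by
      simp only [hP]
      rw [he, poissonKernel_cayley_one (im_I_mul_ofReal_pos (hn n))]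
      simp
      ring
  have hne : ∀ n (e : Metric.sphere (0 : ℂ) 1), (e : ℂ) ≠ 1 → P n e =
      (1 + cayleyReal e ^ 2) * (((n : ℝ) + 1) ^ 2 / (cayleyReal e ^ 2 + ((n : ℝ) + 1) ^ 2)) :=
    fun n e he => by
      simp only [hP]
      rw [poissonKernel_cayley_of_ne_one (im_I_mul_ofReal_pos (hn n)) (norm_eq_of_mem_sphere e) he]
      simp
      ring
  have hP0 : ∀ n e, 0 ≤ P n e := fun n e => by
    by_cases he : (e : ℂ) = 1
    · rw [hone n e he]; positivity
    · rw [hne n e he]; positivity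
  have hnt : Tendsto (fun n : ℕ => (n : ℝ) + 1) atTop atTop :=
    tendsto_atTop_add_const_right _ _ tendsto_natCast_atTop_atTop
  have hlim : ∀ e : Metric.sphere (0 : ℂ) 1, Tendsto (fun n => ENNReal.ofReal (P n e)) atTop
      (𝓝 (if (e : ℂ) = 1 then ⊤ else ENNReal.ofReal (1 + cayleyReal e ^ 2))) := fun e => by
    split_ifs with he
    · simp only [hone _ e he]
      exact ENNReal.tendsto_ofReal_atTop.comp ((tendsto_pow_atTop two_ne_zero).comp hnt)
    · refine (ENNReal.continuous_ofReal.tendsto _).comp ?_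
      simp only [hne _ e he]
      set x := cayleyReal e
      have h1 : Tendsto (fun n : ℕ => (x ^ 2 * (((n : ℝ) + 1)⁻¹) ^ 2 + 1)⁻¹) atTop
          (𝓝 ((x ^ 2 * 0 ^ 2 + 1)⁻¹)) :=
        ((((hnt.inv_tendsto_atTop).pow 2).const_mul _).add_const 1).inv₀ (by norm_num)
      have h2 := h1.const_mul (1 + x ^ 2)
      have h3 : (1 + x ^ 2) * (x ^ 2 * 0 ^ 2 + 1)⁻¹ = 1 + x ^ 2 := by norm_num
      rw [h3] at h2
      refine h2.congr fun n => ?_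
      have := (hn n).ne'
      field_simp
  have hlint : ∀ n, ∫⁻ e, ENNReal.ofReal (P n e) ∂(σ : Measure (Metric.sphere (0 : ℂ) 1))
      ≤ ENNReal.ofReal M := fun n => by
    rw [← ofReal_integral_eq_lintegral_ofReal ((hPc n).integrable_of_hasCompactSupport
      (HasCompactSupport.of_compactSpace _)) (ae_of_all _ (hP0 n))]
    apply ENNReal.ofReal_le_ofReal
    simp only [hP]
    rw [integral_const_mul]
    exact hM _ (hn n)
  -- Fatou's lemma: at `e = 1` the integrands grow like `(n + 1) ^ 2`, which accounts for the value
  -- `⊤`.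
  calc _ = ∫⁻ e, liminf (fun n => ENNReal.ofReal (P n e)) atTop
        ∂(σ : Measure (Metric.sphere (0 : ℂ) 1)) :=
        lintegral_congr fun e => (hlim e).liminf_eq.symm
    _ ≤ liminf (fun n => ∫⁻ e, ENNReal.ofReal (P n e)
        ∂(σ : Measure (Metric.sphere (0 : ℂ) 1))) atTop :=
        lintegral_liminf_le fun n => ENNReal.measurable_ofReal.comp (hPc n).measurable
    _ ≤ ENNReal.ofReal M := by
        refine (liminf_le_liminf (Eventually.of_forall hlint)).trans ?_
        simp

/-- A Poisson representation on the half-plane with a finite measure. -/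
lemma exists_finite_measure_im_eq {G : ℂ → ℂ} (hG : DifferentiableOn ℂ G {z | 0 < z.im})
    (him : ∀ z : ℂ, 0 < z.im → (G z).im < 0) (hbd : ∀ z : ℂ, 0 < z.im → ‖G z‖ ≤ 1 / z.im) :
    ∃ ρ : Measure ℝ, IsFiniteMeasure ρ ∧ ∀ z : ℂ, 0 < z.im →
      (G z).im = -∫ x : ℝ, z.im / ((z.re - x) ^ 2 + z.im ^ 2) ∂ρ := by
  have hne : ∀ w : ℂ, ‖w‖ < 1 → 1 - w ≠ 0 := fun w hw h => by
    rw [← sub_eq_zero.mp h] at hw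
    simp at hw
  have hmap : ∀ w : ℂ, ‖w‖ < 1 → 0 < (I * ((1 + w) / (1 - w))).im := fun w hw => by
    have h1 := normSq_pos.mpr (hne w hw)
    have h2 : normSq w < 1 := by
      rw [normSq_eq_norm_sq]; nlinarith [norm_nonneg w]
    have h3 : (I * ((1 + w) / (1 - w))).im = (1 - normSq w) / normSq (1 - w) := by
      simp [div_re, normSq_apply]
      ring
    rw [h3]
    exact div_pos (by linarith) h1
  -- Multiplication by `I` turns `Im G < 0` into a positive real part on the disc.
  set f : ℂ → ℂ := fun w => I * G (I * ((1 + w) / (1 - w)))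
  have hf : DifferentiableOn ℂ f (Metric.ball 0 1) := by
    refine (hG.comp (t := {z | 0 < z.im}) ?_ fun w hw => hmap w (by simpa using hw)).const_mul I
    refine DifferentiableOn.const_mul ?_ I
    refine DifferentiableOn.div (by fun_prop) (by fun_prop) fun w hw => ?_
    exact hne w (by simpa using hw)
  have hfre : ∀ w, (f w).re = -(G (I * ((1 + w) / (1 - w)))).im := fun w => by simp [f]
  have hf0 : 0 < (f 0).re := by
    rw [hfre]; linarith [him _ (hmap 0 (by simp))]
  obtain ⟨σ, hσ⟩ := exists_measure_re_eq_integral_poissonKernel hf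
    (fun w hw => by rw [hfre]; linarith [him _ (hmap w hw)]) hf0
  set c := (f 0).re
  have hGσ : ∀ z : ℂ, 0 < z.im → -(G z).im = c * ∫ e : Metric.sphere (0 : ℂ) 1,
      poissonKernel 0 ((z - I) / (z + I)) e ∂(σ : Measure (Metric.sphere (0 : ℂ) 1)) :=
    fun z hz => by
      have h0 := add_I_ne_zero hz
      rw [← hσ _ (norm_cayley_lt_one hz), hfre]
      congr 3
      have h1 : 1 - (z - I) / (z + I) = 2 * I / (z + I) := by field_simp; ring
      have h2 : 1 + (z - I) / (z + I) = 2 * z / (z + I) := by field_simp; ring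
      rw [h1, h2]
      field_simp
  have hM : ∀ t : ℝ, 0 < t →
      t * ∫ e : Metric.sphere (0 : ℂ) 1, poissonKernel 0 ((I * t - I) / (I * t + I)) e ∂
        (σ : Measure (Metric.sphere (0 : ℂ) 1)) ≤ 1 / c := fun t ht => by
    have h1 := hGσ _ (im_I_mul_ofReal_pos ht)
    have h2 := (abs_le.mp ((abs_im_le_norm _).trans (hbd _ (im_I_mul_ofReal_pos ht)))).1
    rw [show (I * t : ℂ).im = t by simp] at h2
    rw [le_div_iff₀ hf0]
    calc _ = t * -(G (I * t)).im := by rw [h1]; ring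
      _ ≤ t * (1 / t) := by gcongr; linarith
      _ = 1 := by field_simp
  have hfin := lintegral_one_add_cayleyReal_sq_le σ hM
  have hxm : Measurable fun e : Metric.sphere (0 : ℂ) 1 => cayleyReal e := by
    unfold cayleyReal
    fun_prop
  have hkm : Measurable fun e : Metric.sphere (0 : ℂ) 1 =>
      ENNReal.ofReal (c * (1 + cayleyReal e ^ 2)) := by fun_prop
  have hne1 : ∀ᵐ e : Metric.sphere (0 : ℂ) 1 ∂(σ : Measure (Metric.sphere (0 : ℂ) 1)),
      (e : ℂ) ≠ 1 := by
    have hm : Measurable fun e : Metric.sphere (0 : ℂ) 1 =>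
        (if (e : ℂ) = 1 then (⊤ : ENNReal) else ENNReal.ofReal (1 + cayleyReal e ^ 2)) := by
      refine Measurable.ite ?_ measurable_const (by fun_prop)
      exact measurable_subtype_coe (measurableSet_singleton 1)
    filter_upwards [ae_lt_top hm (hfin.trans_lt ENNReal.ofReal_lt_top).ne] with e he h1
    simp [h1] at he
  set τ := (σ : Measure (Metric.sphere (0 : ℂ) 1)).withDensity
    fun e => ENNReal.ofReal (c * (1 + cayleyReal e ^ 2)) with hτ
  have hτfin : IsFiniteMeasure τ := by
    refine isFiniteMeasure_withDensity ?_
    have h1 : ∫⁻ e : Metric.sphere (0 : ℂ) 1, ENNReal.ofReal (1 + cayleyReal e ^ 2)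
        ∂(σ : Measure (Metric.sphere (0 : ℂ) 1)) ≤ ENNReal.ofReal (1 / c) := by
      refine (lintegral_mono fun e => ?_).trans hfin
      split_ifs <;> simp
    simp_rw [ENNReal.ofReal_mul hf0.le]
    rw [lintegral_const_mul _ (by fun_prop)]
    exact ENNReal.mul_ne_top ENNReal.ofReal_ne_top (h1.trans_lt ENNReal.ofReal_lt_top).ne
  refine ⟨τ.map fun e : Metric.sphere (0 : ℂ) 1 => cayleyReal e, inferInstance, fun z hz => ?_⟩
  rw [integral_map hxm.aemeasurable (Measurable.aestronglyMeasurable (by fun_prop)), hτ,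
    integral_withDensity_eq_integral_toReal_smul hkm (ae_of_all _ fun e => ENNReal.ofReal_lt_top),
    ← neg_inj, neg_neg, hGσ z hz, ← integral_const_mul]
  refine integral_congr_ae ?_
  filter_upwards [hne1] with e he
  rw [poissonKernel_cayley_of_ne_one hz (norm_eq_of_mem_sphere e) he,
    ENNReal.toReal_ofReal (by positivity), smul_eq_mul]
  ring

/-- **Nevanlinna's characterization** of Cauchy transforms of probability measures. -/
theorem exists_cauchyTransform_eq {G : ℂ → ℂ} (hG : DifferentiableOn ℂ G {z | 0 < z.im})
    (him : ∀ z : ℂ, 0 < z.im → (G z).im < 0) (hbd : ∀ z : ℂ, 0 < z.im → ‖G z‖ ≤ 1 / z.im)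
    (hlim : Tendsto (fun t : ℝ => (I * t) * G (I * t)) atTop (𝓝 1)) :
    ∃ ρ : ProbabilityMeasure ℝ, ∀ z : ℂ, 0 < z.im → cauchyTransform ρ z = G z := by
  obtain ⟨ρ, hρ, h⟩ := exists_finite_measure_im_eq hG him hbd
  set K : ℂ → ℂ := fun z => ∫ x : ℝ, 1 / (z - (x : ℂ)) ∂ρ
  have hK := differentiableOn_integral_one_div_sub ρ
  have hopen : IsOpen {z : ℂ | 0 < z.im} := isOpen_lt continuous_const continuous_im
  have himD : ∀ z : ℂ, 0 < z.im → (G z - K z).im = 0 := fun z hz => by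
    rw [sub_im, h z hz, im_integral_one_div_sub ρ hz.ne']
    ring
  -- `G` and the Cauchy integral `K` have equal imaginary parts, so they differ by a constant, which
  -- vanishes because `z G` and `z K` both converge along the imaginary axis.
  obtain ⟨k, hk⟩ := ((hG.sub hK).analyticOnNhd hopen).eq_const_of_im_eq_const (c₀ := 0)
    (fun z hz => himD z hz) hopen
    ⟨⟨I, by simp⟩, (convex_halfSpace_im_gt 0).isPreconnected⟩
  have hk : ∀ z : ℂ, 0 < z.im → G z - K z = k := fun z hz => hk z hz
  have hKlim := tendsto_mul_integral_one_div_sub ρ eventually_norm_I_mul_le tendsto_im_I_mul_atTop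
  have hinv : Tendsto (fun t : ℝ => (I * t : ℂ)⁻¹) atTop (𝓝 0) := by
    rw [tendsto_zero_iff_norm_tendsto_zero]
    simp only [norm_inv, norm_mul, norm_I, one_mul, Complex.norm_real]
    exact (tendsto_norm_atTop_atTop).inv_tendsto_atTop
  have hk0 : k = 0 := by
    have h1 := hinv.mul (hlim.sub hKlim)
    rw [zero_mul] at h1
    refine tendsto_nhds_unique (tendsto_const_nhds.congr' ?_) h1
    filter_upwards [eventually_gt_atTop 0] with t ht
    rw [← mul_sub, ← mul_assoc, inv_mul_cancel₀, one_mul]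
    · exact (hk _ (im_I_mul_ofReal_pos ht)).symm
    · intro h0
      simpa [h0] using im_I_mul_ofReal_pos ht
  have hKG : ∀ z : ℂ, 0 < z.im → K z = G z := fun z hz => by
    have := hk z hz
    rw [hk0] at this
    exact (sub_eq_zero.mp this).symm
  have hmass : ρ.real Set.univ = 1 := by
    have h1 : Tendsto (fun t : ℝ => (I * t : ℂ) * K (I * t)) atTop (𝓝 1) := by
      refine hlim.congr' ?_
      filter_upwards [eventually_gt_atTop 0] with t ht
      rw [hKG _ (im_I_mul_ofReal_pos ht)]
    exact_mod_cast tendsto_nhds_unique hKlim h1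
  have hprob : IsProbabilityMeasure ρ := ⟨by
    rw [← ENNReal.ofReal_toReal (measure_ne_top ρ Set.univ)]
    rw [Measure.real] at hmass
    simp [hmass]⟩
  exact ⟨⟨ρ, hprob⟩, hKG⟩

/-! ### Existence and uniqueness of the convolution -/

lemma isCMonotoneConv_of_im_pos {μ₁ ν₂ μ₂ ρ : ProbabilityMeasure ℝ}
    (h : ∀ z : ℂ, 0 < z.im → recipCauchyTransform ρ z =
      recipCauchyTransform μ₁ (recipCauchyTransform ν₂ z) + recipCauchyTransform μ₂ z
        - recipCauchyTransform ν₂ z) : IsCMonotoneConv μ₁ ν₂ μ₂ ρ := by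
  intro z hz
  rcases lt_or_gt_of_ne hz with h' | h'
  · have := congrArg (starRingEnd ℂ) (h (starRingEnd ℂ z) (by simpa using h'))
    simpa [recipCauchyTransform_conj] using this
  · exact h z h'

lemma isCMonotoneConv_unique {μ₁ ν₂ μ₂ ρ ρ' : ProbabilityMeasure ℝ}
    (h : IsCMonotoneConv μ₁ ν₂ μ₂ ρ) (h' : IsCMonotoneConv μ₁ ν₂ μ₂ ρ') : ρ = ρ' :=
  eq_of_recipCauchyTransform_eq fun z hz => (h z hz.ne').trans (h' z hz.ne').symm

lemma exists_isCMonotoneConv (μ₁ ν₂ μ₂ : ProbabilityMeasure ℝ) :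
    ∃ ρ, IsCMonotoneConv μ₁ ν₂ μ₂ ρ := by
  set w : ℂ → ℂ := recipCauchyTransform ν₂
  set F : ℂ → ℂ := fun z => recipCauchyTransform μ₁ (w z) + recipCauchyTransform μ₂ z - w z
    with hF
  have hw : ∀ z : ℂ, 0 < z.im → 0 < (w z).im := fun z hz => im_recipCauchyTransform_pos ν₂ hz
  have hFim : ∀ z : ℂ, 0 < z.im → z.im ≤ (F z).im := fun z hz => by
    have h1 := im_le_im_recipCauchyTransform μ₁ (hw z hz)
    have h2 := im_le_im_recipCauchyTransform μ₂ hz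
    simp only [hF, sub_im, add_im]
    linarith
  have hF0 : ∀ z : ℂ, 0 < z.im → F z ≠ 0 := fun z hz h => by
    have := hFim z hz
    rw [h, zero_im] at this
    linarith
  have hFd : DifferentiableOn ℂ F {z | 0 < z.im} :=
    (((differentiableOn_recipCauchyTransform μ₁).comp
      (differentiableOn_recipCauchyTransform ν₂) hw).add
      (differentiableOn_recipCauchyTransform μ₂)).sub (differentiableOn_recipCauchyTransform ν₂)
  have hFlim : Tendsto (fun t : ℝ => F (I * t) / (I * t)) atTop (𝓝 1) := by
    have h2 := tendsto_recipCauchyTransform_div μ₂ eventually_norm_I_mul_le tendsto_im_I_mul_atTop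
    have h3 := tendsto_recipCauchyTransform_div ν₂ eventually_norm_I_mul_le tendsto_im_I_mul_atTop
    have hwt : Tendsto (fun t : ℝ => (w (I * t)).im) atTop atTop := by
      refine tendsto_atTop_mono' _ ?_ tendsto_im_I_mul_atTop
      filter_upwards [eventually_gt_atTop 0] with t ht
      exact im_le_im_recipCauchyTransform ν₂ (im_I_mul_ofReal_pos ht)
    -- `|w(it)| < 2t` eventually and `t ≤ Im w(it)`: thus `w(it)` tends to infinity nontangentially,
    -- and the asymptotics of `H_{μ₁}` apply along it.
    have hwb : ∀ᶠ t : ℝ in atTop, ‖w (I * t)‖ ≤ 2 * (w (I * t)).im := by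
      have h4 := h3.norm.eventually_lt_const (u := 2) (by norm_num)
      filter_upwards [h4, eventually_gt_atTop 0] with t h5 ht
      rw [norm_div, div_lt_iff₀ (by simpa using ht.ne')] at h5
      have h6 := im_le_im_recipCauchyTransform ν₂ (im_I_mul_ofReal_pos ht)
      simp [abs_of_pos ht] at h5 h6
      simp only [w]
      linarith
    have h1 := (tendsto_recipCauchyTransform_div μ₁ hwb hwt).mul h3
    have h7 := (h1.add h2).sub h3
    norm_num at h7
    refine h7.congr' ?_
    filter_upwards [eventually_gt_atTop 0] with t ht
    have hw0 : w (I * t) ≠ 0 := fun h => by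
      have := hw _ (im_I_mul_ofReal_pos ht)
      rw [h] at this
      simp at this
    simp only [hF]
    rw [div_mul_div_cancel₀ hw0]
    ring
  obtain ⟨ρ, hρ⟩ := exists_cauchyTransform_eq (G := fun z => 1 / F z)
    ((differentiableOn_const 1).div hFd hF0)
    (fun z hz => by
      rw [one_div, inv_im]
      exact div_neg_of_neg_of_pos (by linarith [hFim z hz]) (normSq_pos.mpr (hF0 z hz)))
    (fun z hz => by
      rw [norm_div, norm_one]
      exact one_div_le_one_div_of_le hz
        ((hFim z hz).trans ((le_abs_self _).trans (abs_im_le_norm _))))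
    (by
      have := hFlim.inv₀ one_ne_zero
      rw [inv_one] at this
      refine this.congr fun t => ?_
      rw [inv_div]
      ring)
  refine ⟨ρ, isCMonotoneConv_of_im_pos fun z hz => ?_⟩
  rw [recipCauchyTransform, hρ z hz, one_div_one_div]

lemma isCMonotoneConv_deformedConv (T : ProbabilityMeasure ℝ → ProbabilityMeasure ℝ)
    (μ ν : ProbabilityMeasure ℝ) : IsCMonotoneConv μ (T ν) ν (deformedConv T μ ν) :=
  Classical.epsilon_spec (exists_isCMonotoneConv μ (T ν) ν)

/-! ### Symmetric measures -/

lemma cauchyTransform_map_neg {μ ν : ProbabilityMeasure ℝ}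
    (h : (ν : Measure ℝ) = (μ : Measure ℝ).map fun x : ℝ => -x) (z : ℂ) :
    cauchyTransform ν z = -cauchyTransform μ (-z) := by
  rw [cauchyTransform, h, integral_map (by fun_prop)
    (measurable_one_div_sub_ofReal z).aestronglyMeasurable, cauchyTransform, ← integral_neg]
  congr 1
  ext x
  rw [← div_neg]
  congr 1
  push_cast
  ring

/-- A measure is symmetric if and only if its reciprocal Cauchy transform is odd. -/
lemma mem_symmetricMeasures_iff {μ : ProbabilityMeasure ℝ} :
    μ ∈ symmetricMeasures ↔
      ∀ z : ℂ, z.im ≠ 0 → recipCauchyTransform μ (-z) = -recipCauchyTransform μ z := by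
  constructor
  · intro h z _
    have := cauchyTransform_map_neg (μ := μ) (ν := μ) h.symm z
    rw [recipCauchyTransform, recipCauchyTransform, this, one_div_neg_eq_neg_one_div, neg_neg]
  · intro h
    have hp : IsProbabilityMeasure ((μ : Measure ℝ).map fun x : ℝ => -x) :=
      Measure.isProbabilityMeasure_map (by fun_prop)
    set ν : ProbabilityMeasure ℝ := ⟨(μ : Measure ℝ).map fun x : ℝ => -x, hp⟩ with hν
    have e : ν = μ := eq_of_recipCauchyTransform_eq fun z hz => by
      rw [recipCauchyTransform, cauchyTransform_map_neg (μ := μ) (ν := ν) rfl,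
        one_div_neg_eq_neg_one_div]
      have := h z hz.ne'
      rw [recipCauchyTransform] at this
      rw [this, neg_neg]
    exact congrArg Subtype.val e

/-- The two-point measure `p δ_a + (1 - p) δ_b`. -/
noncomputable def twoPointMeasure (p : unitInterval) (a b : ℝ) : ProbabilityMeasure ℝ :=
  ⟨ENNReal.ofReal p • Measure.dirac a + ENNReal.ofReal (1 - p) • Measure.dirac b, ⟨by
    simp only [Measure.coe_add, Measure.coe_smul, Pi.add_apply, Pi.smul_apply, measure_univ,
      smul_eq_mul, mul_one]
    rw [← ENNReal.ofReal_add p.2.1 (sub_nonneg.mpr p.2.2)]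
    simp⟩⟩

lemma cauchyTransform_twoPointMeasure (p : unitInterval) (a b : ℝ) (z : ℂ) :
    cauchyTransform (twoPointMeasure p a b) z
      = ((p : ℝ) : ℂ) * (1 / (z - a)) + (1 - ((p : ℝ) : ℂ)) * (1 / (z - b)) := by
  have hi : ∀ (q : ℝ) (x : ℝ), Integrable (fun x : ℝ => 1 / (z - (x : ℂ)))
      (ENNReal.ofReal q • Measure.dirac x) := fun q x =>
    (integrable_dirac (by simp)).smul_measure ENNReal.ofReal_ne_top
  rw [cauchyTransform, twoPointMeasure]
  simp only [ProbabilityMeasure.coe_mk]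
  rw [integral_add_measure (hi _ _) (hi _ _), integral_smul_measure, integral_smul_measure,
    integral_dirac, integral_dirac, ENNReal.toReal_ofReal p.2.1,
    ENNReal.toReal_ofReal (sub_nonneg.mpr p.2.2)]
  simp

/-- The symmetric Bernoulli measure on `{-1, 1}`. -/
noncomputable def bernoulliMeasure : ProbabilityMeasure ℝ :=
  twoPointMeasure ⟨1 / 2, by norm_num, by norm_num⟩ 1 (-1)

lemma recipCauchyTransform_bernoulliMeasure {z : ℂ} (hz : z.im ≠ 0) :
    recipCauchyTransform bernoulliMeasure z = z - 1 / z := by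
  have h0 : z ≠ 0 := by simpa using sub_ofReal_ne_zero_of_im_ne_zero hz 0
  have h1 : z - 1 ≠ 0 := by simpa using sub_ofReal_ne_zero_of_im_ne_zero hz 1
  have h2 : z + 1 ≠ 0 := by simpa using sub_ofReal_ne_zero_of_im_ne_zero hz (-1)
  rw [recipCauchyTransform, bernoulliMeasure, cauchyTransform_twoPointMeasure]
  have : ((((1 : ℝ) / 2 : ℝ) : ℂ)) * (1 / (z - (1 : ℝ))) + (1 - (((1 : ℝ) / 2 : ℝ) : ℂ)) *
      (1 / (z - ((-1 : ℝ) : ℂ))) = z / ((z - 1) * (z + 1)) := by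
    push_cast
    rw [sub_neg_eq_add]
    field_simp
    ring
  rw [this, one_div_div]
  field_simp
  ring

lemma bernoulliMeasure_mem_symmetricMeasures : bernoulliMeasure ∈ symmetricMeasures := by
  rw [mem_symmetricMeasures_iff]
  intro z hz
  rw [recipCauchyTransform_bernoulliMeasure hz, recipCauchyTransform_bernoulliMeasure (by simpa),
    one_div_neg_eq_neg_one_div]
  ring

lemma image_symmetricMeasures_subset_iff (T : ProbabilityMeasure ℝ → ProbabilityMeasure ℝ) :
    T '' symmetricMeasures ⊆ symmetricMeasures ↔
      ∀ μ ∈ symmetricMeasures, ∀ ν ∈ symmetricMeasures,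
        deformedConv T μ ν ∈ symmetricMeasures := by
  rw [Set.image_subset_iff]
  constructor
  · intro hT μ hμ ν hν
    have hτ := mem_symmetricMeasures_iff.mp (hT hν)
    rw [mem_symmetricMeasures_iff] at hμ hν ⊢
    intro z hz
    have hc := isCMonotoneConv_deformedConv T μ ν
    rw [hc z hz, hc (-z) (by simpa using hz), hτ z hz, hν z hz,
      hμ _ (im_recipCauchyTransform_ne_zero _ hz)]
    ring
  · intro h ν hν
    have hd := mem_symmetricMeasures_iff.mp (h _ bernoulliMeasure_mem_symmetricMeasures ν hν)
    show T ν ∈ symmetricMeasures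
    rw [mem_symmetricMeasures_iff] at hν ⊢
    intro z hz
    have hc := isCMonotoneConv_deformedConv T bernoulliMeasure ν
    have hz' : (-z).im ≠ 0 := by simpa using hz
    have h1 := hd z hz
    have hw := im_recipCauchyTransform_ne_zero (T ν) hz
    have hw' := im_recipCauchyTransform_ne_zero (T ν) hz'
    rw [hc z hz, hc (-z) hz', hν z hz, recipCauchyTransform_bernoulliMeasure hw,
      recipCauchyTransform_bernoulliMeasure hw'] at h1
    -- For the Bernoulli measure the convolution has `H = H_ν - 1 / H_{Tν}`; both `H` and `H_ν` are
    -- odd, hence so is `1 / H_{Tν}`.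
    have h2 : 1 / recipCauchyTransform (T ν) (-z) = 1 / -recipCauchyTransform (T ν) z := by
      rw [one_div_neg_eq_neg_one_div]
      linear_combination -h1
    simpa only [one_div, inv_inj] using h2

/-! ### Measures on the half-line -/

lemma mem_positiveMeasures_iff_measure_Iio {μ : ProbabilityMeasure ℝ} :
    μ ∈ positiveMeasures ↔ (μ : Measure ℝ) (Set.Iio 0) = 0 := by
  constructor
  · intro h
    have hsub : Set.Iio 0 ⊆ (μ : Measure ℝ).supportᶜ := fun x hx hs =>
      absurd (Set.mem_Ici.mp (h hs)) (not_le.mpr hx)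
    exact measure_mono_null hsub Measure.measure_compl_support
  · intro h
    refine Measure.support_subset_of_isClosed isClosed_Ici ?_
    rw [mem_ae_iff, Set.compl_Ici]
    exact h

lemma im_mul_one_div_sub (z : ℂ) (x : ℝ) :
    (z * (1 / (z - (x : ℂ)))).im = -(z.im * (x / ((z.re - x) ^ 2 + z.im ^ 2))) := by
  simp [normSq_apply]
  ring

lemma integrable_mul_one_div_sub (μ : Measure ℝ) [IsFiniteMeasure μ] {z : ℂ} (hz : z.im ≠ 0) :
    Integrable (fun x : ℝ => z * (1 / (z - (x : ℂ)))) μ :=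
  (integrable_one_div_sub_ofReal μ hz).const_mul z

lemma integrable_div_sq_add_sq (μ : Measure ℝ) [IsFiniteMeasure μ] {z : ℂ} (hz : z.im ≠ 0) :
    Integrable (fun x : ℝ => x / ((z.re - x) ^ 2 + z.im ^ 2)) μ := by
  have h := ((integrable_mul_one_div_sub μ hz).im).const_mul (-z.im⁻¹)
  refine h.congr (ae_of_all _ fun x => ?_)
  have := im_mul_one_div_sub z x
  simp only [RCLike.im_to_complex] at *
  rw [this]
  field_simp

lemma im_mul_cauchyTransform (μ : ProbabilityMeasure ℝ) {z : ℂ} (hz : z.im ≠ 0) :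
    (z * cauchyTransform μ z).im
      = -(z.im * ∫ x : ℝ, x / ((z.re - x) ^ 2 + z.im ^ 2) ∂(μ : Measure ℝ)) := by
  rw [← integral_const_mul, ← integral_neg, cauchyTransform, ← integral_const_mul]
  simp_rw [← im_mul_one_div_sub]
  exact (integral_im (integrable_mul_one_div_sub (μ : Measure ℝ) hz)).symm

/-- `H(z) / z` is the inverse of `z G(z)`, and inversion reverses the sign of the imaginary part. -/
lemma im_recipCauchyTransform_div_nonneg_iff (μ : ProbabilityMeasure ℝ) {z : ℂ} (hz : 0 < z.im) :
    0 ≤ (recipCauchyTransform μ z / z).im ↔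
      0 ≤ ∫ x : ℝ, x / ((z.re - x) ^ 2 + z.im ^ 2) ∂(μ : Measure ℝ) := by
  have hz0 : z ≠ 0 := fun h => by simp [h] at hz
  have h0 := normSq_pos.mpr (mul_ne_zero hz0 (cauchyTransform_ne_zero μ hz.ne'))
  have : recipCauchyTransform μ z / z = (z * cauchyTransform μ z)⁻¹ := by
    rw [recipCauchyTransform, mul_inv]; ring
  rw [this, inv_im, im_mul_cauchyTransform μ hz.ne', neg_neg, le_div_iff₀ h0, zero_mul,
    mul_nonneg_iff_of_pos_left hz]

/-- If `|φ y - φ x| ≤ C |y - x| ^ 2` locally uniformly on `(-∞, a)`, then `φ` is constant there. -/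
lemma eq_of_abs_sub_le_mul_sq {φ : ℝ → ℝ} {a C δ : ℝ} (hδ : 0 < δ)
    (h : ∀ x y, x < y → y < a → y - x < δ → |φ y - φ x| ≤ C * (y - x) ^ 2)
    {x y : ℝ} (hx : x < a) (hy : y < a) : φ x = φ y := by
  have key : ∀ x < a, HasDerivAt φ 0 x := fun x hx => by
    rw [hasDerivAt_iff_isLittleO]
    simp only [smul_zero, sub_zero]
    have hO : (fun y => φ y - φ x) =O[𝓝 x] fun y => (y - x) ^ 2 := by
      refine Asymptotics.IsBigO.of_bound C ?_
      filter_upwards [Iio_mem_nhds hx, Ioo_mem_nhds (sub_lt_self x hδ) (lt_add_of_pos_right x hδ)]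
        with y hya hyx
      rw [Real.norm_eq_abs, Real.norm_of_nonneg (sq_nonneg _)]
      rcases lt_trichotomy x y with hxy | rfl | hxy
      · exact h x y hxy hya (by linarith [hyx.2])
      · simp
      · rw [abs_sub_comm, ← neg_sub x y, neg_sq]
        exact h y x hxy hx (by linarith [hyx.1])
    refine hO.trans_isLittleO ?_
    have : Tendsto (fun y => y - x) (𝓝 x) (𝓝 0) := by
      simpa using (continuous_id.sub continuous_const).tendsto (x := x) (f := fun y : ℝ => y - x)
    simpa [Function.comp_def] using
      (Asymptotics.isLittleO_pow_id one_lt_two).comp_tendsto this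
  exact (convex_Iio a).is_const_of_fderivWithin_eq_zero (𝕜 := ℝ)
    (fun z hz => (key z hz).differentiableAt.differentiableWithinAt)
    (fun z hz => by
      rw [fderivWithin_of_isOpen isOpen_Iio hz]
      ext
      simpa using (key z hz).deriv) hx hy

/-- Nonnegativity of the integral forces an interval of radius `y` to the left of `-a` to have mass
`O(y ^ 2)`. The distribution function then has zero derivative on every `(-∞, b / 2)` with `b < 0`,
so it is constant there, equal to its limit `0` at `-∞`. -/
lemma measure_Iio_zero_eq_zero (μ : ProbabilityMeasure ℝ)
    (h : ∀ x y : ℝ, 0 < y → 0 ≤ ∫ t : ℝ, t / ((x - t) ^ 2 + y ^ 2) ∂(μ : Measure ℝ)) :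
    (μ : Measure ℝ) (Set.Iio 0) = 0 := by
  have small : ∀ a : ℝ, 0 < a → ∀ x y : ℝ, x ≤ -a → 0 < y → y ≤ a / 2 →
      (μ : Measure ℝ).real (Set.Icc (x - y) (x + y)) ≤ 4 / a ^ 2 * y ^ 2 := by
    intro a ha x y hx hy hya
    -- On the interval `t ≤ -a / 2` and the denominator is at most `2 y ^ 2`; off it, for `t > 0`,
    -- `(x - t) ^ 2 ≥ (t + a) ^ 2 ≥ a t`.
    have hpt : ∀ t : ℝ, t / ((x - t) ^ 2 + y ^ 2)
        ≤ 1 / a - (Set.Icc (x - y) (x + y)).indicator (fun _ => a / (4 * y ^ 2)) t := fun t => by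
      have hden : 0 < (x - t) ^ 2 + y ^ 2 := by positivity
      by_cases ht : t ∈ Set.Icc (x - y) (x + y)
      · rw [Set.indicator_of_mem ht]
        have h1 : t ≤ -(a / 2) := by linarith [ht.2]
        have h2 : (x - t) ^ 2 ≤ y ^ 2 := by
          apply sq_le_sq'
          · linarith [ht.2]
          · linarith [ht.1]
        have h3 : t / ((x - t) ^ 2 + y ^ 2) ≤ -(a / (4 * y ^ 2)) := by
          rw [← neg_div, div_le_div_iff₀ hden (by positivity)]
          nlinarith [sq_nonneg y]
        have : 0 < 1 / a := by positivity
        linarith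
      · rw [Set.indicator_of_notMem ht, sub_zero, div_le_div_iff₀ hden ha]
        rcases le_or_gt t 0 with h0 | h0
        · nlinarith
        · nlinarith [sq_nonneg y, sq_nonneg (t - a), sq_nonneg (x + a), mul_pos h0 ha]
    have hi1 : Integrable (fun t : ℝ => t / ((x - t) ^ 2 + y ^ 2)) (μ : Measure ℝ) :=
      integrable_div_sq_add_sq (μ : Measure ℝ) (z := ⟨x, y⟩) hy.ne'
    have hi2 : Integrable ((Set.Icc (x - y) (x + y)).indicator (fun _ => a / (4 * y ^ 2)))
        (μ : Measure ℝ) := (integrable_const _).indicator measurableSet_Icc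
    have h1 := integral_mono hi1 ((integrable_const (1 / a)).sub hi2) hpt
    have h2 := (h x y hy).trans h1
    simp only [Pi.sub_apply] at h2
    rw [integral_sub (integrable_const _) hi2, integral_indicator_const _ measurableSet_Icc] at h2
    simp only [integral_const, probReal_univ, smul_eq_mul] at h2
    have h3 : (μ : Measure ℝ).real (Set.Icc (x - y) (x + y)) * (a / (4 * y ^ 2)) ≤ 1 / a := by
      linarith
    rw [← le_div_iff₀ (by positivity)] at h3
    refine h3.trans_eq ?_
    field_simp
  have zero : ∀ b < 0, (μ : Measure ℝ) (Set.Iic b) = 0 := by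
    intro b hb
    set φ : ℝ → ℝ := fun x => (μ : Measure ℝ).real (Set.Iic x)
    have hφ : ∀ x < b / 2, φ x = φ b := fun x hx => by
      refine eq_of_abs_sub_le_mul_sq (a := b / 2) (δ := -b / 2) (C := 4 / (b / 2) ^ 2)
        (by linarith) (fun x y hxy hy hδ => ?_) hx (by linarith)
      have h1 := small (-(b / 2)) (by linarith) ((x + y) / 2) ((y - x) / 2) (by linarith)
        (by linarith) (by linarith)
      have h2 : (μ : Measure ℝ).real (Set.Iic y \ Set.Iic x) = φ y - φ x :=
        measureReal_sdiff (Set.Iic_subset_Iic.mpr hxy.le) measurableSet_Iic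
      rw [← h2, abs_of_nonneg measureReal_nonneg]
      refine (measureReal_mono (fun t ht => ?_)).trans (h1.trans ?_)
      · have h3 : t ≤ y := ht.1
        have h4 : x < t := not_le.mp ht.2
        constructor <;> linarith
      · rw [neg_sq]
        refine mul_le_mul_of_nonneg_left ?_ (by positivity)
        nlinarith [sq_nonneg (y - x)]
    have hlim : Tendsto (fun n : ℕ => (μ : Measure ℝ) (Set.Iic (-(n : ℝ)))) atTop (𝓝 0) := by
      have := tendsto_measure_iInter_atTop (μ := (μ : Measure ℝ))
        (s := fun n : ℕ => Set.Iic (-(n : ℝ))) (fun n => measurableSet_Iic.nullMeasurableSet)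
        (fun m n hmn => Set.Iic_subset_Iic.mpr (by simpa using hmn)) ⟨0, measure_ne_top _ _⟩
      have he : (⋂ n : ℕ, Set.Iic (-(n : ℝ))) = ∅ := by
        ext x
        simp only [Set.mem_iInter, Set.mem_Iic, Set.mem_empty_iff_false, iff_false, not_forall,
          not_le]
        obtain ⟨n, hn⟩ := exists_nat_gt (-x)
        exact ⟨n, by linarith⟩
      rwa [he, measure_empty] at this
    have hev : ∀ᶠ n : ℕ in atTop, (μ : Measure ℝ) (Set.Iic (-(n : ℝ)))
        = (μ : Measure ℝ) (Set.Iic b) := by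
      filter_upwards [eventually_gt_atTop ⌈-(b / 2)⌉₊] with n hn
      have h1 := hφ (-(n : ℝ)) (by linarith [Nat.lt_of_ceil_lt hn])
      exact (ENNReal.toReal_eq_toReal_iff' (measure_ne_top _ _) (measure_ne_top _ _)).mp h1
    exact tendsto_nhds_unique (tendsto_const_nhds.congr' (hev.mono fun n hn => hn.symm)) hlim
  have hU : Set.Iio (0 : ℝ) = ⋃ n : ℕ, Set.Iic (-(1 / ((n : ℝ) + 1))) := by
    ext x
    simp only [Set.mem_Iio, Set.mem_iUnion, Set.mem_Iic]
    constructor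
    · intro hx
      obtain ⟨n, hn⟩ := exists_nat_one_div_lt (neg_pos.mpr hx)
      exact ⟨n, by linarith⟩
    · rintro ⟨n, hn⟩
      have : 0 < 1 / ((n : ℝ) + 1) := by positivity
      linarith
  rw [hU, measure_iUnion_null_iff]
  intro n
  have : 0 < 1 / ((n : ℝ) + 1) := by positivity
  exact zero _ (by linarith)

/-- A probability measure lives on `[0, ∞)` if and only if `H(z) / z` maps the upper half-plane
to its closure. -/
lemma mem_positiveMeasures_iff {μ : ProbabilityMeasure ℝ} :
    μ ∈ positiveMeasures ↔ ∀ z : ℂ, 0 < z.im → 0 ≤ (recipCauchyTransform μ z / z).im := by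
  rw [mem_positiveMeasures_iff_measure_Iio]
  constructor
  · intro h z hz
    rw [im_recipCauchyTransform_div_nonneg_iff μ hz]
    refine integral_nonneg_of_ae ?_
    have : ∀ᵐ x ∂(μ : Measure ℝ), x ∉ Set.Iio 0 := measure_eq_zero_iff_ae_notMem.mp h
    filter_upwards [this] with x hx
    have : 0 ≤ x := not_lt.mp hx
    simp only [Pi.zero_apply]
    positivity
  · intro h
    refine measure_Iio_zero_eq_zero μ fun x y hy => ?_
    exact (im_recipCauchyTransform_div_nonneg_iff μ (z := ⟨x, y⟩) hy).mp (h ⟨x, y⟩ hy)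

/-- Monotonicity of the argument: if `arg z ≤ arg w ≤ arg u`, all in `[0, π]`, then
`arg z ≤ arg u`. -/
lemma im_div_nonneg_trans {u w z : ℂ} (hz : 0 < z.im) (hw : 0 < w.im) (hu : 0 ≤ u.im)
    (huw : 0 ≤ (u / w).im) (hwz : 0 ≤ (w / z).im) : 0 ≤ (u / z).im := by
  have hz0 : z ≠ 0 := fun h => by simp [h] at hz
  have hw0 : w ≠ 0 := fun h => by simp [h] at hw
  have key : ∀ a b : ℂ, b ≠ 0 → (0 ≤ (a / b).im ↔ 0 ≤ a.im * b.re - a.re * b.im) :=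
    fun a b hb => by
      rw [div_im, div_sub_div_same, le_div_iff₀ (normSq_pos.mpr hb), zero_mul]
  rw [key _ _ hw0] at huw
  rw [key _ _ hz0] at hwz ⊢
  -- Writing `[a, b] = Im a Re b - Re a Im b`, one has `Im w [u, z] = Im z [u, w] + Im u [w, z]`.
  have h1 : 0 ≤ w.im * (u.im * z.re - u.re * z.im) := by
    nlinarith [mul_nonneg huw hz.le, mul_nonneg hwz hu]
  exact nonneg_of_mul_nonneg_right h1 hw

lemma twoPointMeasure_mem_positiveMeasures (p : unitInterval) {a : ℝ} (ha : 0 ≤ a) :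
    twoPointMeasure p 0 a ∈ positiveMeasures := by
  rw [mem_positiveMeasures_iff_measure_Iio]
  simp [twoPointMeasure, ha]

lemma recipCauchyTransform_twoPointMeasure (p : unitInterval) (a : ℝ) {w : ℂ} (hw : w.im ≠ 0) :
    recipCauchyTransform (twoPointMeasure p 0 a) w - w
      = -((1 - (p : ℝ)) * a * w / (w - ((p * a : ℝ) : ℂ))) := by
  have h0 : w ≠ 0 := by simpa using sub_ofReal_ne_zero_of_im_ne_zero hw 0
  have h1 := sub_ofReal_ne_zero_of_im_ne_zero hw a
  have h2 := sub_ofReal_ne_zero_of_im_ne_zero hw (p * a)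
  have h3 : cauchyTransform (twoPointMeasure p 0 a) w
      = (w - ((p * a : ℝ) : ℂ)) / (w * (w - a)) := by
    rw [cauchyTransform_twoPointMeasure, ofReal_zero, sub_zero]
    field_simp
    push_cast
    ring
  rw [recipCauchyTransform, h3, one_div_div, eq_neg_iff_add_eq_zero]
  field_simp
  push_cast
  ring

lemma image_positiveMeasures_subset_iff (T : ProbabilityMeasure ℝ → ProbabilityMeasure ℝ) :
    T '' positiveMeasures ⊆ positiveMeasures ↔
      ∀ μ ∈ positiveMeasures, ∀ ν ∈ positiveMeasures, deformedConv T μ ν ∈ positiveMeasures := by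
  rw [Set.image_subset_iff]
  constructor
  · intro hT μ hμ ν hν
    have hτ := mem_positiveMeasures_iff.mp (hT hν)
    rw [mem_positiveMeasures_iff] at hμ hν ⊢
    intro z hz
    rw [isCMonotoneConv_deformedConv T μ ν z hz.ne']
    set w := recipCauchyTransform (T ν) z
    have hw : 0 < w.im := im_recipCauchyTransform_pos (T ν) hz
    have hw0 : w ≠ 0 := fun h => by simp [h] at hw
    have h1 : 0 ≤ ((recipCauchyTransform μ w - w) / z).im := by
      refine im_div_nonneg_trans hz hw ?_ ?_ (hτ z hz)
      · rw [sub_im]; linarith [im_le_im_recipCauchyTransform μ hw]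
      · rw [sub_div, div_self hw0, sub_im, one_im, sub_zero]
        exact hμ w hw
    have h2 := hν z hz
    have e : (recipCauchyTransform μ w + recipCauchyTransform ν z - w) / z
        = (recipCauchyTransform μ w - w) / z + recipCauchyTransform ν z / z := by ring
    rw [e, add_im]
    exact add_nonneg h1 h2
  · intro h ν hν
    show T ν ∈ positiveMeasures
    rw [mem_positiveMeasures_iff]
    intro z hz
    set w := recipCauchyTransform (T ν) z
    have hw : 0 < w.im := im_recipCauchyTransform_pos (T ν) hz
    have hn : ∀ n : ℕ, (0 : ℝ) < n + 1 := fun n => by positivity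
    -- With `N = n + 1`, mass `1 / N` at `0` and second atom `N ^ 2`, the pole `p a` of `H(w) - w`
    -- sits at `N`, and `(H(w) - w) / N = (1 - 1 / N) w / (1 - w / N)`.
    let p : ℕ → unitInterval := fun n => ⟨((n : ℝ) + 1)⁻¹, (inv_pos.mpr (hn n)).le,
      inv_le_one_of_one_le₀ (by linarith [(Nat.cast_nonneg n : (0 : ℝ) ≤ n)])⟩
    have hpos : ∀ n : ℕ, 0 ≤ ((((n : ℝ) + 1 : ℝ) : ℂ)⁻¹ * (recipCauchyTransform
        (twoPointMeasure (p n) 0 (((n : ℝ) + 1) ^ 2)) w - w + recipCauchyTransform ν z) / z).im :=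
      fun n => by
        have h1 := mem_positiveMeasures_iff.mp (h _ (twoPointMeasure_mem_positiveMeasures (p n)
          (sq_nonneg ((n : ℝ) + 1))) ν hν) z hz
        rw [isCMonotoneConv_deformedConv T _ ν z hz.ne'] at h1
        rw [mul_div_assoc, ← ofReal_inv, im_ofReal_mul]
        refine mul_nonneg (inv_pos.mpr (hn n)).le ?_
        rwa [sub_add_eq_add_sub]
    have hinv : Tendsto (fun n : ℕ => ((((n : ℝ) + 1 : ℝ) : ℂ)⁻¹)) atTop (𝓝 0) := by
      have h1 : Tendsto (fun n : ℕ => ((n : ℝ) + 1)⁻¹) atTop (𝓝 0) :=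
        (tendsto_atTop_add_const_right _ _ tendsto_natCast_atTop_atTop).inv_tendsto_atTop
      have h2 := (continuous_ofReal.tendsto 0).comp h1
      simpa [Function.comp_def] using h2
    have hlim : Tendsto (fun n : ℕ => (((n : ℝ) + 1 : ℝ) : ℂ)⁻¹ * (recipCauchyTransform
        (twoPointMeasure (p n) 0 (((n : ℝ) + 1) ^ 2)) w - w + recipCauchyTransform ν z) / z)
        atTop (𝓝 (w / z)) := by
      have h1 : Tendsto (fun n : ℕ => (1 - (((n : ℝ) + 1 : ℝ) : ℂ)⁻¹) * w /
          (1 - (((n : ℝ) + 1 : ℝ) : ℂ)⁻¹ * w)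
          + (((n : ℝ) + 1 : ℝ) : ℂ)⁻¹ * recipCauchyTransform ν z) atTop
          (𝓝 ((1 - 0) * w / (1 - 0 * w) + 0 * recipCauchyTransform ν z)) :=
        ((((tendsto_const_nhds.sub hinv).mul_const w).div
          (tendsto_const_nhds.sub (hinv.mul_const w)) (by simp)).add (hinv.mul_const _))
      simp only [sub_zero, one_mul, zero_mul, div_one, add_zero] at h1
      refine (h1.div_const z).congr fun n => ?_
      rw [recipCauchyTransform_twoPointMeasure _ _ hw.ne']
      have hN : (((n : ℝ) + 1 : ℝ) : ℂ) ≠ 0 := by exact_mod_cast (hn n).ne'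
      have hpa : ((p n : ℝ) * ((n : ℝ) + 1) ^ 2 : ℝ) = (n : ℝ) + 1 := by
        simp only [p]
        field_simp [(hn n).ne']
      have hd := sub_ofReal_ne_zero_of_im_ne_zero hw.ne' ((n : ℝ) + 1)
      rw [hpa]
      have hpn : (((p n : unitInterval) : ℝ) : ℂ) = (((n : ℝ) + 1 : ℝ) : ℂ)⁻¹ := by
        simp only [p, ofReal_inv]
      rw [hpn, ofReal_pow]
      generalize (((n : ℝ) + 1 : ℝ) : ℂ) = N at *
      have hd' : N - w ≠ 0 := fun h => hd (by linear_combination -h)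
      have hd2 : 1 - N⁻¹ * w ≠ 0 := fun h => hd' (by field_simp at h; linear_combination h)
      have e : (1 - N⁻¹) * w / (1 - N⁻¹ * w) = -(N⁻¹ * ((1 - N⁻¹) * N ^ 2 * w / (w - N))) := by
        rw [← neg_sub N w, div_neg]
        field_simp
      rw [e]
      ring
    exact ge_of_tendsto' ((continuous_im.tendsto _).comp hlim) hpos

theorem mainTheorem10 (T : ProbabilityMeasure ℝ → ProbabilityMeasure ℝ) :
    -- the convolution is well defined: the equation for `H` has exactly one solution,
    -- and `deformedConv T μ ν` is that solution
    (∀ μ ν : ProbabilityMeasure ℝ,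
      IsCMonotoneConv μ (T ν) ν (deformedConv T μ ν) ∧
        ∀ ρ : ProbabilityMeasure ℝ, IsCMonotoneConv μ (T ν) ν ρ → ρ = deformedConv T μ ν) ∧
    -- measures supported on the half-line
    (T '' positiveMeasures ⊆ positiveMeasures ↔
      ∀ μ ∈ positiveMeasures, ∀ ν ∈ positiveMeasures, deformedConv T μ ν ∈ positiveMeasures) ∧
    -- symmetric measures
    (T '' symmetricMeasures ⊆ symmetricMeasures ↔
      ∀ μ ∈ symmetricMeasures, ∀ ν ∈ symmetricMeasures,
        deformedConv T μ ν ∈ symmetricMeasures) :=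
  ⟨fun μ ν => ⟨isCMonotoneConv_deformedConv T μ ν,
    fun _ hρ => isCMonotoneConv_unique hρ (isCMonotoneConv_deformedConv T μ ν)⟩,
    image_positiveMeasures_subset_iff T, image_symmetricMeasures_subset_iff T⟩
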